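/- Let $G$ be a connected semisimple real linear Lie group, that is, a closed connected subgroup of $GL_n(\mathbb R)$ for some $n$ whose Lie algebra is semisimple. A subgroup $H\subset G$ is called Zariski dense (in $G$) if every real polynomial in the matrix entries that vanishes on $H$ vanishes on $G$. A subgroup $\Gamma\subset G$ is called normally irreducible if $N\cap\Gamma=\{\mathrm{Id}\}$ for every normal subgroup $N\triangleleft G$ with $N\neq G$. Proposition. Let $\Gamma\subset G$ be a Zariski dense subgroup. Then all nontrivial normal subgroups $\Gamma'\triangleleft\Gamma$ are Zariski dense in $G$ if and only if $\Gamma$ is normally irreducible. -/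

import Mathlib

open scoped MatrixGroups

section Exponential

open NormedSpace Filter Topology

theorem norm_pow_sub_pow_le_aux {A : Type*} [NormedRing A] [NormOneClass A] {a b : A} {M : ℝ} (hM : 1 ≤ M)
    (ha : ‖a‖ ≤ M) (hb : ‖b‖ ≤ M) (k : ℕ) : ‖a ^ k - b ^ k‖ ≤ k * M ^ k * ‖a - b‖ := by
  have hM0 : 0 ≤ M := zero_le_one.trans hM
  induction k with
  | zero => simp
  | succ k ih =>
    have e : a ^ (k + 1) - b ^ (k + 1) = a ^ k * (a - b) + (a ^ k - b ^ k) * b := by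
      rw [pow_succ, pow_succ]; noncomm_ring
    have h1 : ‖a ^ k‖ ≤ M ^ k :=
      (norm_pow_le a k).trans (pow_le_pow_left₀ (norm_nonneg _) ha k)
    have h2 : M ^ k ≤ M ^ (k + 1) := pow_le_pow_right₀ hM (Nat.le_succ k)
    have h3 : 0 ≤ ‖a - b‖ := norm_nonneg _
    calc ‖a ^ (k + 1) - b ^ (k + 1)‖
        ≤ ‖a ^ k‖ * ‖a - b‖ + ‖a ^ k - b ^ k‖ * ‖b‖ := by
          rw [e]
          exact (norm_add_le _ _).trans (add_le_add (norm_mul_le _ _) (norm_mul_le _ _))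
      _ ≤ M ^ (k + 1) * ‖a - b‖ + (k * M ^ k * ‖a - b‖) * M := by
          refine add_le_add (mul_le_mul_of_nonneg_right (h1.trans h2) h3) ?_
          exact mul_le_mul ih hb (norm_nonneg _) (by positivity)
      _ = ((k + 1 : ℕ) : ℝ) * M ^ (k + 1) * ‖a - b‖ := by push_cast; ring

variable {A : Type*} [NormedRing A] [NormedAlgebra ℝ A] [CompleteSpace A]

/-- If `c` is a curve through `1` with velocity `X` at time `0`, then `c (1 / k) ^ k` tends to
`exp X`. -/
theorem tendsto_curve_pow_exp [NormOneClass A] {c : ℝ → A} {X : A} (h0 : c 0 = 1)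
    (hc : HasDerivAt c X 0) :
    Tendsto (fun k : ℕ => c ((k : ℝ)⁻¹) ^ k) atTop (𝓝 (exp X)) := by
  let _ : NormedAlgebra ℚ A := .restrictScalars ℚ ℝ A
  have hu : Tendsto (fun k : ℕ => ((k : ℝ)⁻¹)) atTop (𝓝[≠] 0) :=
    tendsto_nhdsWithin_iff.2 ⟨tendsto_inv_atTop_nhds_zero_nat,
      (eventually_gt_atTop 0).mono fun k hk => by simp; omega⟩
  have key : ∀ f : ℝ → A, f 0 = 1 → HasDerivAt f X 0 →
      Tendsto (fun k : ℕ => (k : ℝ) • (f ((k : ℝ)⁻¹) - 1)) atTop (𝓝 X) := by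
    intro f f0 hf
    have := (hasDerivAt_iff_tendsto_slope_zero.1 hf).comp hu
    refine this.congr fun k => ?_
    simp [f0]
  have hexp : HasDerivAt (fun t : ℝ => exp (t • X)) X 0 := by
    simpa using hasDerivAt_exp_smul_const X (0 : ℝ)
  have k1 := key c h0 hc
  have k2 := key _ (by simp) hexp
  set C : ℝ := ‖X‖ + 1 with hC
  have hC0 : 0 ≤ C := by positivity
  have bound : ∀ f : ℝ → A,
      Tendsto (fun k : ℕ => (k : ℝ) • (f ((k : ℝ)⁻¹) - 1)) atTop (𝓝 X) →
      ∀ᶠ k : ℕ in atTop, ‖f ((k : ℝ)⁻¹)‖ ≤ 1 + C / k := by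
    intro f hf
    have h := hf.norm.eventually_le_const (show ‖X‖ < C by linarith)
    filter_upwards [h, eventually_gt_atTop 0] with k hk hk0
    have hk0' : (0 : ℝ) < k := by exact_mod_cast hk0
    rw [norm_smul, Real.norm_natCast] at hk
    have h1 : ‖f ((k : ℝ)⁻¹) - 1‖ ≤ C / k := by
      rw [le_div_iff₀ hk0']; linarith
    calc ‖f ((k : ℝ)⁻¹)‖ = ‖1 + (f ((k : ℝ)⁻¹) - 1)‖ := by congr 1; abel
      _ ≤ ‖(1 : A)‖ + ‖f ((k : ℝ)⁻¹) - 1‖ := norm_add_le _ _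
      _ ≤ 1 + C / k := by rw [norm_one]; linarith
  have b1 := bound c k1
  have b2 := bound (fun t : ℝ => exp (t • X)) k2
  have hdiff : Tendsto (fun k : ℕ => Real.exp C *
      ‖(k : ℝ) • (c ((k : ℝ)⁻¹) - exp ((k : ℝ)⁻¹ • X))‖) atTop (𝓝 0) := by
    have := ((k1.sub k2).norm).const_mul (Real.exp C)
    simp only [sub_self, norm_zero, mul_zero] at this
    refine this.congr fun k => ?_
    rw [← smul_sub]; congr 3; abel
  rw [tendsto_iff_norm_sub_tendsto_zero]
  refine squeeze_zero' (Eventually.of_forall fun _ => norm_nonneg _) ?_ hdiff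
  filter_upwards [b1, b2, eventually_gt_atTop 0] with k h1 h2 hk0
  have hk0' : (0 : ℝ) < k := by exact_mod_cast hk0
  have e : exp X = exp ((k : ℝ)⁻¹ • X) ^ k := by
    rw [← exp_nsmul]
    congr 1
    rw [← Nat.cast_smul_eq_nsmul ℝ, smul_smul, mul_inv_cancel₀ hk0'.ne', one_smul]
  rw [e]
  have hM : (1 : ℝ) ≤ 1 + C / k := by
    have : 0 ≤ C / k := by positivity
    linarith
  refine (norm_pow_sub_pow_le_aux hM h1 h2 k).trans ?_
  have hpow : (1 + C / k) ^ k ≤ Real.exp C := by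
    have : 1 + C / k ≤ Real.exp (C / k) := by linarith [Real.add_one_le_exp (C / k)]
    calc (1 + C / k) ^ k ≤ Real.exp (C / k) ^ k := pow_le_pow_left₀ (by linarith) this k
      _ = Real.exp C := by
        rw [← Real.exp_nat_mul]; congr 1; field_simp
  rw [norm_smul, Real.norm_natCast]
  calc (k : ℝ) * (1 + C / k) ^ k * ‖c ((k : ℝ)⁻¹) - exp ((k : ℝ)⁻¹ • X)‖
      ≤ (k : ℝ) * Real.exp C * ‖c ((k : ℝ)⁻¹) - exp ((k : ℝ)⁻¹ • X)‖ := by gcongr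
    _ = _ := by ring

/-- If `G` is a closed subgroup of the units and `c` is a curve in `G` through `1` with velocity
`X`, then the one-parameter group of `X` lies in `G`. -/
theorem exp_mem_of_curve [NormOneClass A] {G : Subgroup Aˣ} (hG : IsClosed (G : Set Aˣ))
    {c : ℝ → Aˣ} {X : A} (hcG : ∀ t, c t ∈ G) (h0 : c 0 = 1)
    (hc : HasDerivAt (fun t => (c t : A)) X 0) (t : ℝ) :
    ∃ g ∈ G, (g : A) = exp (t • X) := by
  let _ : NormedAlgebra ℚ A := .restrictScalars ℚ ℝ A
  have hct : HasDerivAt (fun s : ℝ => (c (t * s) : A)) (t • X) 0 := by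
    have h1 : HasDerivAt (fun s : ℝ => t * s) t 0 := by
      simpa using (hasDerivAt_id (0 : ℝ)).const_mul t
    have h2 : HasDerivAt (fun t => (c t : A)) X (t * 0) := by simpa using hc
    exact h2.scomp (0 : ℝ) h1
  have lim := tendsto_curve_pow_exp (c := fun s : ℝ => (c (t * s) : A)) (by simp [h0]) hct
  obtain ⟨u, hu⟩ := isUnit_exp (t • X)
  refine ⟨u, ?_, hu⟩
  have lim' : Tendsto (fun k : ℕ => c (t * (k : ℝ)⁻¹) ^ k) atTop (𝓝 u) := by
    rw [Units.isOpenEmbedding_val.tendsto_nhds_iff, hu]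
    refine lim.congr fun k => ?_
    simp
  exact hG.mem_of_tendsto lim' (Eventually.of_forall fun k => G.pow_mem (hcG _) k)

end Exponential

section LinearGroups

open NormedSpace Filter Topology

attribute [local instance] LieRing.ofAssociativeRing

variable {n : ℕ}

/-- `X` is tangent to the matrix group `G` if `exp (t X)` belongs to `G` for all real `t`. -/
def IsTangent (G : Subgroup (GL (Fin n) ℝ)) (X : Matrix (Fin n) (Fin n) ℝ) : Prop :=
  ∀ t : ℝ, ∃ g ∈ G, (g : Matrix (Fin n) (Fin n) ℝ) = exp (t • X)

open scoped Matrix.Norms.Operator in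
theorem isTangent_of_curve {G : Subgroup (GL (Fin n) ℝ)}
    (hG : IsClosed (G : Set (GL (Fin n) ℝ))) {c : ℝ → GL (Fin n) ℝ}
    {X : Matrix (Fin n) (Fin n) ℝ} (hcG : ∀ t, c t ∈ G) (h0 : c 0 = 1)
    (hc : HasDerivAt (fun t => (c t : Matrix (Fin n) (Fin n) ℝ)) X 0) : IsTangent G X := by
  intro t
  rcases isEmpty_or_nonempty (Fin n) with h | h
  · exact ⟨1, G.one_mem, Subsingleton.elim _ _⟩
  · exact exp_mem_of_curve hG hcG h0 hc t

theorem IsTangent.smul {G : Subgroup (GL (Fin n) ℝ)} {X : Matrix (Fin n) (Fin n) ℝ}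
    (hX : IsTangent G X) (r : ℝ) : IsTangent G (r • X) := fun t => by
  obtain ⟨g, hg, e⟩ := hX (t * r)
  exact ⟨g, hg, by rw [e, smul_smul]⟩

open scoped Matrix.Norms.Operator in
theorem hasDerivAt_exp_smul_zero_aux (X : Matrix (Fin n) (Fin n) ℝ) :
    HasDerivAt (fun t : ℝ => exp (t • X)) X 0 := by
  have h := hasDerivAt_exp_smul_const X (0 : ℝ)
  simp only [zero_smul, exp_zero, one_mul] at h
  exact h

open scoped Matrix.Norms.Operator in
theorem IsTangent.add {G : Subgroup (GL (Fin n) ℝ)}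
    (hG : IsClosed (G : Set (GL (Fin n) ℝ))) {X Y : Matrix (Fin n) (Fin n) ℝ}
    (hX : IsTangent G X) (hY : IsTangent G Y) : IsTangent G (X + Y) := by
  choose a haG ha using hX
  choose b hbG hb using hY
  refine isTangent_of_curve hG (c := fun t => a t * b t) (fun t => G.mul_mem (haG t) (hbG t)) ?_ ?_
  · apply Units.ext; simp [ha, hb]
  · have h := (hasDerivAt_exp_smul_zero_aux X).mul (hasDerivAt_exp_smul_zero_aux Y)
    simp only [Pi.mul_def, zero_smul, exp_zero, one_mul, mul_one] at h
    simp only [Units.val_mul, ha, hb]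
    exact h

theorem IsTangent.conj {G : Subgroup (GL (Fin n) ℝ)} {Y : Matrix (Fin n) (Fin n) ℝ}
    (hY : IsTangent G Y) {g : GL (Fin n) ℝ} (hg : g ∈ G) :
    IsTangent G ((g : Matrix (Fin n) (Fin n) ℝ) * Y *
      ((g⁻¹ : GL (Fin n) ℝ) : Matrix (Fin n) (Fin n) ℝ)) := fun t => by
  obtain ⟨h, hh, e⟩ := hY t
  refine ⟨g * h * g⁻¹, G.mul_mem (G.mul_mem hg hh) (G.inv_mem hg), ?_⟩
  rw [← Matrix.smul_mul, ← Matrix.mul_smul]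
  simp only [Units.val_mul, e]
  exact (Matrix.exp_units_conj g (t • Y)).symm

/-- The tangent vectors of a closed matrix group, as a linear subspace. -/
def tangentSubmodule (G : Subgroup (GL (Fin n) ℝ)) (hG : IsClosed (G : Set (GL (Fin n) ℝ))) :
    Submodule ℝ (Matrix (Fin n) (Fin n) ℝ) where
  carrier := {X | IsTangent G X}
  add_mem' hX hY := IsTangent.add hG hX hY
  zero_mem' := fun _ => ⟨1, G.one_mem, by simp⟩
  smul_mem' r _ hX := IsTangent.smul hX r

open scoped Matrix.Norms.Operator in
theorem IsTangent.lie {G : Subgroup (GL (Fin n) ℝ)}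
    (hG : IsClosed (G : Set (GL (Fin n) ℝ))) {X Y : Matrix (Fin n) (Fin n) ℝ}
    (hX : IsTangent G X) (hY : IsTangent G Y) : IsTangent G ⁅X, Y⁆ := by
  have hcl : IsClosed (tangentSubmodule G hG : Set (Matrix (Fin n) (Fin n) ℝ)) :=
    Submodule.closed_of_finiteDimensional _
  have hconj : ∀ t : ℝ, exp (t • X) * Y * exp ((-t) • X) ∈ tangentSubmodule G hG := by
    intro t
    obtain ⟨g, hg, e⟩ := hX t
    have e' : ((g⁻¹ : GL (Fin n) ℝ) : Matrix (Fin n) (Fin n) ℝ) = exp ((-t) • X) := by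
      rw [Matrix.coe_units_inv, e, neg_smul, Matrix.exp_neg]
    rw [← e, ← e']
    exact IsTangent.conj hY hg
  have hd : HasDerivAt (fun t : ℝ => exp (t • X) * Y * exp ((-t) • X)) ⁅X, Y⁆ 0 := by
    have h1 := (hasDerivAt_exp_smul_zero_aux X).mul_const Y
    have h2 : HasDerivAt (fun t : ℝ => exp ((-t) • X)) (-X) 0 := by
      simpa using hasDerivAt_exp_smul_zero_aux (-X)
    have h := h1.mul h2
    simp only [Pi.mul_def] at h
    convert! h using 1
    simp [LieRing.of_associative_ring_bracket, sub_eq_add_neg]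
  have hslope := hasDerivAt_iff_tendsto_slope_zero.1 hd
  refine hcl.mem_of_tendsto hslope (Eventually.of_forall fun t => ?_)
  refine Submodule.smul_mem _ _ (Submodule.sub_mem _ (hconj _) (hconj _))

/-- The Lie algebra `{X | ∀ t, exp (t X) ∈ G}` of a closed subgroup `G` of `GL_n(ℝ)`, with the
commutator bracket. -/
def matrixLieAlgebra (G : Subgroup (GL (Fin n) ℝ)) (hG : IsClosed (G : Set (GL (Fin n) ℝ))) :
    LieSubalgebra ℝ (Matrix (Fin n) (Fin n) ℝ) where
  toSubmodule := tangentSubmodule G hG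
  lie_mem' hX hY := IsTangent.lie hG hX hY

/-- A connected semisimple real linear Lie group: a closed connected subgroup of `GL_n(ℝ)` whose
Lie algebra is semisimple. -/
structure IsConnectedSemisimpleLinearGroup (G : Subgroup (GL (Fin n) ℝ)) : Prop where
  isClosed : IsClosed (G : Set (GL (Fin n) ℝ))
  isConnected : IsConnected (G : Set (GL (Fin n) ℝ))
  isSemisimple : LieAlgebra.IsSemisimple ℝ (matrixLieAlgebra G isClosed)

/-- The Zariski closure in `GL_n(ℝ)`: the common zeros of all real polynomials in the matrix
entries that vanish on `S`. (Allowing powers of `1 / det` would not change the zero sets.) -/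
def zariskiClosure (S : Set (GL (Fin n) ℝ)) : Set (GL (Fin n) ℝ) :=
  {g | ∀ p : MvPolynomial (Fin n × Fin n) ℝ,
    (∀ s ∈ S, p.eval (fun ij => (s : Matrix (Fin n) (Fin n) ℝ) ij.1 ij.2) = 0) →
      p.eval (fun ij => (g : Matrix (Fin n) (Fin n) ℝ) ij.1 ij.2) = 0}

/-- A subgroup `H` of the matrix group `G` is Zariski dense in `G`. -/
def IsZariskiDense {G : Subgroup (GL (Fin n) ℝ)} (H : Subgroup G) : Prop :=
  (G : Set (GL (Fin n) ℝ)) ⊆ zariskiClosure ((fun h : G => (h : GL (Fin n) ℝ)) '' (H : Set G))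

end LinearGroups

/-- `Γ` is normally irreducible in `G` if it meets every proper normal subgroup of `G`
trivially. -/
def IsNormallyIrreducible {G : Type*} [Group G] (Γ : Subgroup G) : Prop :=
  ∀ N : Subgroup G, N.Normal → N ≠ ⊤ → N ⊓ Γ = ⊥

/-! The heart is that an abstract normal subgroup `N` of `G` which is Zariski dense equals `G`
(`eq_top_of_isZariskiDense`); no closedness of `N` is assumed.

Let `m` be the span of all `X - h X h⁻¹` with `X` in the Lie algebra of `G` and `h ∈ N`. For fixed
`Y` in the Lie algebra, the condition `g Y g⁻¹ - Y ∈ m` is Zariski closed in `g` and holds on `N`,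
hence on `G`. Differentiating along `exp (t X)` gives `⁅X, Y⁆ ∈ m`, and since a semisimple Lie
algebra is perfect, `m` contains it all. Now `X - h X h⁻¹` is the velocity at `0` of the commutator
`exp (t X) h exp (-t X) h⁻¹`, which stays in `N`. Products of such commutators fill a neighbourhood
of `1` in `G`, by the inverse function argument of `eventually_mem_of_le_coinvariantSpan`. So `N` is
open, and `N = G` by connectedness.

Given this, if a proper normal `N` met `Γ` nontrivially, `N ∩ Γ` would be a nontrivial normal
subgroup of `Γ`, hence dense, forcing `N = G`. Conversely, the Zariski closure in `G` of a normal
subgroup of `Γ` is normalized by the closure of `Γ`, hence by `G`; if the subgroup is nontrivial,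
this closure meets `Γ` nontrivially and must be `G`. -/

/-! ### Regular functions and Zariski closures of matrix groups -/

section RegularFunctions

variable {n : ℕ}

/-- The algebra of functions on `GL_n(ℝ)` generated by the matrix entries of `g` and `g⁻¹`. -/
def regularFunctions (n : ℕ) : Subalgebra ℝ (GL (Fin n) ℝ → ℝ) :=
  Algebra.adjoin ℝ ({f | ∃ i j, f = fun g : GL (Fin n) ℝ => (g : Matrix (Fin n) (Fin n) ℝ) i j} ∪
    {f | ∃ i j, f = fun g : GL (Fin n) ℝ => ((g⁻¹ : GL (Fin n) ℝ) : Matrix (Fin n) (Fin n) ℝ) i j})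

theorem eval_det_mvPolynomialX (g : Matrix (Fin n) (Fin n) ℝ) :
    (Matrix.mvPolynomialX (Fin n) (Fin n) ℝ).det.eval (fun ij => g ij.1 ij.2) = g.det := by
  rw [RingHom.map_det, Matrix.mvPolynomialX_mapMatrix_eval]

theorem eval_adjugate_mvPolynomialX (g : Matrix (Fin n) (Fin n) ℝ) (i j : Fin n) :
    ((Matrix.mvPolynomialX (Fin n) (Fin n) ℝ).adjugate i j).eval (fun ij => g ij.1 ij.2) =
      g.adjugate i j := by
  have h := RingHom.map_adjugate (MvPolynomial.eval fun ij : Fin n × Fin n => g ij.1 ij.2)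
    (Matrix.mvPolynomialX (Fin n) (Fin n) ℝ)
  rw [Matrix.mvPolynomialX_mapMatrix_eval] at h
  exact congrFun (congrFun h i) j

/-- A regular function becomes polynomial after multiplication by a power of the determinant. -/
theorem exists_det_pow_mul_eq_eval {f : GL (Fin n) ℝ → ℝ} (hf : f ∈ regularFunctions n) :
    ∃ (k : ℕ) (p : MvPolynomial (Fin n × Fin n) ℝ), ∀ g : GL (Fin n) ℝ,
      (g : Matrix (Fin n) (Fin n) ℝ).det ^ k * f g =
        p.eval (fun ij => (g : Matrix (Fin n) (Fin n) ℝ) ij.1 ij.2) := by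
  induction hf using Algebra.adjoin_induction with
  | mem f hf =>
    rcases hf with ⟨i, j, rfl⟩ | ⟨i, j, rfl⟩
    · exact ⟨0, MvPolynomial.X (i, j), fun g => by simp⟩
    · refine ⟨1, (Matrix.mvPolynomialX (Fin n) (Fin n) ℝ).adjugate i j, fun g => ?_⟩
      change _ * ((g⁻¹ : GL (Fin n) ℝ) : Matrix (Fin n) (Fin n) ℝ) i j = _
      have hd : IsUnit (g : Matrix (Fin n) (Fin n) ℝ).det :=
        (Matrix.isUnit_iff_isUnit_det _).1 g.isUnit
      rw [eval_adjugate_mvPolynomialX, Matrix.coe_units_inv, Matrix.inv_def, Matrix.smul_apply,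
        Ring.inverse_eq_inv', smul_eq_mul, pow_one, mul_inv_cancel_left₀ hd.ne_zero]
  | algebraMap r => exact ⟨0, MvPolynomial.C r, fun g => by simp⟩
  | add f₁ f₂ _ _ h₁ h₂ =>
    obtain ⟨k₁, p₁, h₁⟩ := h₁
    obtain ⟨k₂, p₂, h₂⟩ := h₂
    refine ⟨k₁ + k₂, (Matrix.mvPolynomialX (Fin n) (Fin n) ℝ).det ^ k₂ * p₁ +
      (Matrix.mvPolynomialX (Fin n) (Fin n) ℝ).det ^ k₁ * p₂, fun g => ?_⟩
    simp only [map_add, map_mul, map_pow, eval_det_mvPolynomialX, ← h₁, ← h₂, Pi.add_apply]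
    ring
  | mul f₁ f₂ _ _ h₁ h₂ =>
    obtain ⟨k₁, p₁, h₁⟩ := h₁
    obtain ⟨k₂, p₂, h₂⟩ := h₂
    refine ⟨k₁ + k₂, p₁ * p₂, fun g => ?_⟩
    simp only [map_mul, ← h₁, ← h₂, Pi.mul_apply]
    ring

theorem coord_mem_regularFunctions (i j : Fin n) :
    (fun g : GL (Fin n) ℝ => (g : Matrix (Fin n) (Fin n) ℝ) i j) ∈ regularFunctions n :=
  Algebra.subset_adjoin (Or.inl ⟨i, j, rfl⟩)

theorem inv_coord_mem_regularFunctions (i j : Fin n) :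
    (fun g : GL (Fin n) ℝ => ((g⁻¹ : GL (Fin n) ℝ) : Matrix (Fin n) (Fin n) ℝ) i j) ∈
      regularFunctions n :=
  Algebra.subset_adjoin (Or.inr ⟨i, j, rfl⟩)

theorem eval_mem_regularFunctions (p : MvPolynomial (Fin n × Fin n) ℝ) :
    (fun g : GL (Fin n) ℝ => p.eval (fun ij => (g : Matrix (Fin n) (Fin n) ℝ) ij.1 ij.2)) ∈
      regularFunctions n := by
  induction p using MvPolynomial.induction_on with
  | C r => simp only [MvPolynomial.eval_C]; exact (regularFunctions n).algebraMap_mem r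
  | add p q hp hq => simp only [map_add]; exact (regularFunctions n).add_mem hp hq
  | mul_X p ij hp =>
    simp only [map_mul, MvPolynomial.eval_X]
    exact (regularFunctions n).mul_mem hp
      (coord_mem_regularFunctions ij.1 ij.2)

/-- The determinant never vanishes on `GL_n(ℝ)`, so denominators can be cleared. This makes
inversion and conjugation usable as regular maps. -/
theorem mem_zariskiClosure_iff {S : Set (GL (Fin n) ℝ)} {g : GL (Fin n) ℝ} :
    g ∈ zariskiClosure S ↔ ∀ f ∈ regularFunctions n, (∀ s ∈ S, f s = 0) → f g = 0 := by
  constructor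
  · intro hg f hf hS
    obtain ⟨k, p, hp⟩ := exists_det_pow_mul_eq_eval hf
    have hd : IsUnit (g : Matrix (Fin n) (Fin n) ℝ).det :=
      (Matrix.isUnit_iff_isUnit_det _).1 g.isUnit
    have h := hg p fun s hs => by rw [← hp, hS s hs, mul_zero]
    rw [← hp] at h
    exact (mul_eq_zero.1 h).resolve_left (pow_ne_zero _ hd.ne_zero)
  · exact fun h p hp => h _ (eval_mem_regularFunctions p) hp

/-- A self-map of `GL_n(ℝ)` is regular if the entries of its values and of their inverses are
regular functions. -/
def IsRegularMap (φ : GL (Fin n) ℝ → GL (Fin n) ℝ) : Prop :=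
  ∀ i j, (fun g => (φ g : Matrix (Fin n) (Fin n) ℝ) i j) ∈ regularFunctions n ∧
    (fun g => (((φ g)⁻¹ : GL (Fin n) ℝ) : Matrix (Fin n) (Fin n) ℝ) i j) ∈ regularFunctions n

theorem isRegularMap_id : IsRegularMap (fun g : GL (Fin n) ℝ => g) := fun i j =>
  ⟨coord_mem_regularFunctions i j, inv_coord_mem_regularFunctions i j⟩

theorem isRegularMap_const (h : GL (Fin n) ℝ) : IsRegularMap (fun _ => h) := fun _ _ =>
  ⟨(regularFunctions n).algebraMap_mem _, (regularFunctions n).algebraMap_mem _⟩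

theorem IsRegularMap.inv {φ : GL (Fin n) ℝ → GL (Fin n) ℝ} (hφ : IsRegularMap φ) :
    IsRegularMap (fun g => (φ g)⁻¹) := fun i j =>
  ⟨(hφ i j).2, by simpa only [inv_inv] using (hφ i j).1⟩

theorem matrix_mul_apply_mem_regularFunctions {A B : GL (Fin n) ℝ → Matrix (Fin n) (Fin n) ℝ}
    (hA : ∀ i j, (fun g => A g i j) ∈ regularFunctions n)
    (hB : ∀ i j, (fun g => B g i j) ∈ regularFunctions n) (i j : Fin n) :
    (fun g => (A g * B g) i j) ∈ regularFunctions n := by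
  have h : (fun g => (A g * B g) i j) = ∑ k, (fun g => A g i k) * fun g => B g k j := by
    ext g
    simp [Matrix.mul_apply]
  rw [h]
  exact Subalgebra.sum_mem _ fun k _ => Subalgebra.mul_mem _ (hA i k) (hB k j)

theorem IsRegularMap.mul {φ ψ : GL (Fin n) ℝ → GL (Fin n) ℝ} (hφ : IsRegularMap φ)
    (hψ : IsRegularMap ψ) : IsRegularMap (fun g => φ g * ψ g) := fun i j => by
  simp only [mul_inv_rev, Units.val_mul]
  exact ⟨matrix_mul_apply_mem_regularFunctions (fun i j => (hφ i j).1) (fun i j => (hψ i j).1) i j,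
    matrix_mul_apply_mem_regularFunctions (fun i j => (hψ i j).2) (fun i j => (hφ i j).2) i j⟩

theorem IsRegularMap.comp_mem {φ : GL (Fin n) ℝ → GL (Fin n) ℝ} (hφ : IsRegularMap φ)
    {f : GL (Fin n) ℝ → ℝ} (hf : f ∈ regularFunctions n) :
    (fun g => f (φ g)) ∈ regularFunctions n := by
  induction hf using Algebra.adjoin_induction with
  | mem f hf =>
    rcases hf with ⟨i, j, rfl⟩ | ⟨i, j, rfl⟩
    · exact (hφ i j).1
    · exact (hφ i j).2
  | algebraMap r => exact (regularFunctions n).algebraMap_mem r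
  | add f₁ f₂ _ _ h₁ h₂ => exact (regularFunctions n).add_mem h₁ h₂
  | mul f₁ f₂ _ _ h₁ h₂ => exact (regularFunctions n).mul_mem h₁ h₂

theorem subset_zariskiClosure (S : Set (GL (Fin n) ℝ)) : S ⊆ zariskiClosure S :=
  fun _ hs _ hp => hp _ hs

theorem zariskiClosure_mono {S T : Set (GL (Fin n) ℝ)} (h : S ⊆ T) :
    zariskiClosure S ⊆ zariskiClosure T :=
  fun _ hg p hp => hg p fun s hs => hp s (h hs)

/-- Regular maps are continuous for the Zariski topology. -/
theorem IsRegularMap.mem_zariskiClosure {φ : GL (Fin n) ℝ → GL (Fin n) ℝ} (hφ : IsRegularMap φ)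
    {S T : Set (GL (Fin n) ℝ)} (h : ∀ s ∈ S, φ s ∈ zariskiClosure T) {g : GL (Fin n) ℝ}
    (hg : g ∈ zariskiClosure S) : φ g ∈ zariskiClosure T :=
  mem_zariskiClosure_iff.2 fun _ hf hT => mem_zariskiClosure_iff.1 hg _ (hφ.comp_mem hf)
    fun s hs => mem_zariskiClosure_iff.1 (h s hs) _ hf hT

/-- The Zariski closure of a matrix group is a matrix group. -/
def zariskiClosureSubgroup (H : Subgroup (GL (Fin n) ℝ)) : Subgroup (GL (Fin n) ℝ) where
  carrier := zariskiClosure H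
  one_mem' := subset_zariskiClosure _ H.one_mem
  -- One variable at a time: left translation by `s ∈ H` sends `b` into the closure, then right
  -- translation by `b` sends `a` there.
  mul_mem' {_ b} ha hb :=
    (isRegularMap_id.mul (isRegularMap_const b)).mem_zariskiClosure (fun s hs =>
      ((isRegularMap_const s).mul isRegularMap_id).mem_zariskiClosure (fun _ ht =>
        subset_zariskiClosure _ (H.mul_mem hs ht)) hb) ha
  inv_mem' ha := isRegularMap_id.inv.mem_zariskiClosure
    (fun _ hs => subset_zariskiClosure _ (H.inv_mem hs)) ha

/-- If `S` normalizes `H`, then the Zariski closure of `S` normalizes that of `H`. -/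
theorem conj_mem_zariskiClosure {S H : Set (GL (Fin n) ℝ)}
    (h : ∀ s ∈ S, ∀ x ∈ H, s * x * s⁻¹ ∈ H) {g x : GL (Fin n) ℝ} (hg : g ∈ zariskiClosure S)
    (hx : x ∈ zariskiClosure H) : g * x * g⁻¹ ∈ zariskiClosure H :=
  -- Again one variable at a time: first `s ↦ s y s⁻¹` with `y ∈ H` fixed, then `x ↦ g x g⁻¹`.
  (((isRegularMap_const g).mul isRegularMap_id).mul (isRegularMap_const g⁻¹)).mem_zariskiClosure
    (fun y hy => ((isRegularMap_id.mul (isRegularMap_const y)).mul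
      isRegularMap_id.inv).mem_zariskiClosure
        (fun s hs => subset_zariskiClosure _ (h s hs y hy)) hg) hx

/-- The condition `g X g⁻¹ - X ∈ m` on `g` is Zariski closed. -/
theorem conj_sub_mem_of_mem_zariskiClosure {S : Set (GL (Fin n) ℝ)}
    {m : Submodule ℝ (Matrix (Fin n) (Fin n) ℝ)} {X : Matrix (Fin n) (Fin n) ℝ}
    (hS : ∀ s ∈ S, (s : Matrix (Fin n) (Fin n) ℝ) * X *
      ((s⁻¹ : GL (Fin n) ℝ) : Matrix (Fin n) (Fin n) ℝ) - X ∈ m)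
    {g : GL (Fin n) ℝ} (hg : g ∈ zariskiClosure S) :
    (g : Matrix (Fin n) (Fin n) ℝ) * X *
      ((g⁻¹ : GL (Fin n) ℝ) : Matrix (Fin n) (Fin n) ℝ) - X ∈ m := by
  by_contra hgm
  -- A linear functional separating the vector from `m` reduces membership to the vanishing of one
  -- regular function.
  obtain ⟨φ, hφ, hm⟩ := Submodule.exists_le_ker_of_notMem hgm
  refine hφ (mem_zariskiClosure_iff.1 hg (fun g => φ ((g : Matrix (Fin n) (Fin n) ℝ) * X *
      ((g⁻¹ : GL (Fin n) ℝ) : Matrix (Fin n) (Fin n) ℝ) - X)) ?_ fun s hs => hm (hS s hs))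
  have e : (fun g : GL (Fin n) ℝ => φ ((g : Matrix (Fin n) (Fin n) ℝ) * X *
      ((g⁻¹ : GL (Fin n) ℝ) : Matrix (Fin n) (Fin n) ℝ) - X)) =
      (∑ i, ∑ j, φ (Matrix.single i j 1) • fun g : GL (Fin n) ℝ =>
        ((g : Matrix (Fin n) (Fin n) ℝ) * X *
          ((g⁻¹ : GL (Fin n) ℝ) : Matrix (Fin n) (Fin n) ℝ)) i j) -
        algebraMap ℝ (GL (Fin n) ℝ → ℝ) (φ X) := by
    ext g
    have hsingle : ∀ i j (c : ℝ),
        φ (Matrix.single i j c) = c * φ (Matrix.single i j 1) := fun i j c => by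
      rw [← smul_eq_mul, ← map_smul, Matrix.smul_single, smul_eq_mul, mul_one]
    rw [map_sub]
    conv_lhs => rw [Matrix.matrix_eq_sum_single ((g : Matrix (Fin n) (Fin n) ℝ) * X *
          ((g⁻¹ : GL (Fin n) ℝ) : Matrix (Fin n) (Fin n) ℝ))]
    simp only [map_sum, Pi.sub_apply, Finset.sum_apply, Pi.smul_apply, smul_eq_mul,
      Pi.algebraMap_apply, Algebra.algebraMap_self, RingHom.id_apply]
    congr 1
    refine Finset.sum_congr rfl fun i _ => Finset.sum_congr rfl fun j _ => ?_
    rw [mul_comm]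
    exact hsingle i j _
  rw [e]
  refine Subalgebra.sub_mem _ (Subalgebra.sum_mem _ fun i _ => Subalgebra.sum_mem _ fun j _ =>
    Subalgebra.smul_mem _ ?_ _) (Subalgebra.algebraMap_mem _ _)
  exact matrix_mul_apply_mem_regularFunctions (matrix_mul_apply_mem_regularFunctions
    coord_mem_regularFunctions fun _ _ => Subalgebra.algebraMap_mem _ _)
    inv_coord_mem_regularFunctions i j

end RegularFunctions

/-- A semisimple Lie algebra is perfect. -/
theorem LieAlgebra.IsSemisimple.lie_top_top_eq_top {R L : Type*} [CommRing R] [LieRing L]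
    [LieAlgebra R L] [LieAlgebra.IsSemisimple R L] :
    ⁅(⊤ : LieIdeal R L), (⊤ : LieIdeal R L)⁆ = ⊤ := by
  set I : LieIdeal R L := ⁅(⊤ : LieIdeal R L), (⊤ : LieIdeal R L)⁆ with hI
  -- The complement of the derived ideal is abelian, since its brackets lie in both ideals;
  -- semisimplicity then makes it zero.
  have h : ⁅Iᶜ, Iᶜ⁆ = (⊥ : LieIdeal R L) := by
    rw [eq_bot_iff, ← inf_compl_self I]
    exact le_inf (LieSubmodule.mono_lie le_top le_top) (LieSubmodule.lie_le_right _ _)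
  have hab : IsLieAbelian (Iᶜ : LieIdeal R L) :=
    (LieSubmodule.lie_abelian_iff_lie_self_eq_bot _).2 h
  have : Iᶜ = ⊥ := (LieAlgebra.hasTrivialRadical_iff_no_abelian_ideals R L).1 inferInstance _ hab
  rwa [compl_eq_bot] at this

/-! ### Normal subgroups of closed groups of units near the identity -/

section BanachAlgebra

open NormedSpace Filter Topology

variable {A : Type*} [NormedRing A] [NormedAlgebra ℝ A]

/-- `X` is tangent to the group of units `G` if `exp (t X)` belongs to `G` for all real `t`. -/
def IsExpTangent (G : Subgroup Aˣ) (X : A) : Prop :=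
  ∀ t : ℝ, ∃ g ∈ G, (g : A) = exp (t • X)

/-- The span of the vectors `X - h X h⁻¹`, where `X` is tangent to `G` and `h` belongs to `N`. -/
noncomputable def coinvariantSpan (G N : Subgroup Aˣ) : Submodule ℝ A :=
  Submodule.span ℝ {Z | ∃ X, IsExpTangent G X ∧ ∃ h ∈ N, Z = X - (h : A) * X *
    ((h⁻¹ : Aˣ) : A)}

theorem val_inv_eq_exp_neg [CompleteSpace A] {g : Aˣ} {y : A} (h : (g : A) = exp y) :
    ((g⁻¹ : Aˣ) : A) = exp (-y) := by
  let _ : NormedAlgebra ℚ A := .restrictScalars ℚ ℝ A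
  refine Units.inv_eq_of_mul_eq_one_right ?_
  rw [h, ← exp_add_of_commute (Commute.neg_right (Commute.refl y)), add_neg_cancel, exp_zero]

theorem val_zpow_eq_exp_zsmul [CompleteSpace A] {g : Aˣ} {y : A} (h : (g : A) = exp y) (m : ℤ) :
    ((g ^ m : Aˣ) : A) = exp (m • y) := by
  let _ : NormedAlgebra ℚ A := .restrictScalars ℚ ℝ A
  cases m with
  | ofNat m => rw [Int.ofNat_eq_natCast, zpow_natCast, natCast_zsmul, Units.val_pow_eq_pow_val, h,
      exp_nsmul]
  | negSucc m =>
    rw [zpow_negSucc, negSucc_zsmul]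
    exact val_inv_eq_exp_neg (by rw [Units.val_pow_eq_pow_val, h, exp_nsmul])

/-- A germ at `0` of a map into `N ⊆ Aˣ` through `1`, with strict derivative `L`. -/
def HasGerm (N : Subgroup Aˣ) (L : A →L[ℝ] A) : Prop :=
  ∃ F : A → Aˣ, (∀ x, F x ∈ N) ∧ F 0 = 1 ∧
    HasStrictFDerivAt (fun x => (F x : A)) L 0

theorem HasGerm.zero (N : Subgroup Aˣ) : HasGerm N 0 :=
  ⟨fun _ => 1, fun _ => N.one_mem, rfl, hasStrictFDerivAt_const _ _⟩

theorem HasGerm.add {N : Subgroup Aˣ} {L₁ L₂ : A →L[ℝ] A}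
    (h₁ : HasGerm N L₁) (h₂ : HasGerm N L₂) : HasGerm N (L₁ + L₂) := by
  obtain ⟨F₁, m₁, z₁, d₁⟩ := h₁
  obtain ⟨F₂, m₂, z₂, d₂⟩ := h₂
  refine ⟨fun x => F₁ x * F₂ x, fun x => N.mul_mem (m₁ x) (m₂ x), by simp [z₁, z₂], ?_⟩
  have h := d₁.mul' d₂
  simp only [z₁, z₂, Units.val_one] at h
  simp only [Units.val_mul]
  convert! h using 1
  ext x : 1
  simp [add_comm]

theorem HasGerm.sum {N : Subgroup Aˣ} {ι : Type*} (s : Finset ι)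
    {L : ι → A →L[ℝ] A} (h : ∀ i ∈ s, HasGerm N (L i)) : HasGerm N (∑ i ∈ s, L i) :=
  Finset.sum_induction L (HasGerm N) (fun _ _ => HasGerm.add) (HasGerm.zero N) h

variable [CompleteSpace A]

/-- The germ is the commutator of `exp (φ x • X)` with `h`, which lies in `N` because `G` normalizes
`N`. -/
theorem hasGerm_smulRight_sub_conj {G N : Subgroup Aˣ}
    (hN : ∀ g ∈ G, ∀ h ∈ N, g * h * g⁻¹ ∈ N) {X : A}
    (hX : IsExpTangent G X) {h : Aˣ} (hh : h ∈ N) (φ : A →L[ℝ] ℝ) :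
    HasGerm N (φ.smulRight (X - (h : A) * X * ((h⁻¹ : Aˣ) : A))) := by
  choose a haG ha using hX
  have ha' : ∀ t, (((a t)⁻¹ : Aˣ) : A) = exp (t • (-X)) := by
    intro t
    rw [smul_neg, val_inv_eq_exp_neg (ha t)]
  refine ⟨fun x => a (φ x) * h * (a (φ x))⁻¹ * h⁻¹,
    fun x => N.mul_mem (hN _ (haG _) _ hh) (N.inv_mem hh), ?_, ?_⟩
  · have : a 0 = 1 := Units.ext (by simp [ha])
    simp [this]
  · have hd : ∀ Y : A, HasStrictFDerivAt (fun x => exp (φ x • Y)) (φ.smulRight Y) 0 := by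
      intro Y
      have h1 : HasStrictFDerivAt (exp : A → _) (1 : A →L[ℝ] A) (φ.smulRight Y 0) := by
        simpa using hasStrictFDerivAt_exp_zero (𝕂 := ℝ) (𝔸 := A)
      exact h1.comp 0 (φ.smulRight Y).hasStrictFDerivAt
    simp only [Units.val_mul, ha, ha']
    have hm := (((hd X).mul_const' (h : A)).mul' (hd (-X))).mul_const' ((h⁻¹ : Aˣ) : A)
    convert! hm using 1
    ext x : 1
    simp [sub_eq_add_neg, mul_assoc, add_comm]

/-- Sums come from products of germs, and a scalar on `Z` is absorbed into `φ`; hence `φ` is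
quantified inside the induction. -/
theorem hasGerm_smulRight {G N : Subgroup Aˣ}
    (hN : ∀ g ∈ G, ∀ h ∈ N, g * h * g⁻¹ ∈ N) {Z : A}
    (hZ : Z ∈ coinvariantSpan G N) :
    ∀ φ : A →L[ℝ] ℝ, HasGerm N (φ.smulRight Z) := by
  induction hZ using Submodule.span_induction with
  | mem Z hZ =>
    obtain ⟨X, hX, h, hh, rfl⟩ := hZ
    exact hasGerm_smulRight_sub_conj hN hX hh
  | zero =>
    intro φ
    convert HasGerm.zero N
    ext x : 1
    simp
  | add Y Z _ _ hY hZ =>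
    intro φ
    convert (hY φ).add (hZ φ)
    ext x : 1
    simp
  | smul r Z _ hZ =>
    intro φ
    convert hZ (r • φ) using 1
    ext x : 1
    simp [smul_smul, mul_comm]

/-- If `exp Y_k` belongs to the closed subgroup `G`, where `Y_k ≠ 0` tends to `0` and the directions
`Y_k / ‖Y_k‖` tend to `Y`, then `Y` is tangent to `G`. -/
theorem isExpTangent_of_tendsto_direction {G : Subgroup Aˣ}
    (hG : IsClosed (G : Set Aˣ)) {y : ℕ → A} {Y : A} (hy : ∀ k, ∃ g ∈ G, (g : A) = exp (y k))
    (hy0 : ∀ k, y k ≠ 0) (hlim : Tendsto y atTop (𝓝 0))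
    (hdir : Tendsto (fun k => ‖y k‖⁻¹ • y k) atTop (𝓝 Y)) : IsExpTangent G Y := by
  let _ : NormedAlgebra ℚ A := .restrictScalars ℚ ℝ A
  intro t
  choose g hgG hg using hy
  -- Integer powers of `exp (y k)` approximate `exp (t • Y)`: rounding `t / ‖y k‖` costs at most `‖y
  -- k‖`, which tends to `0`.
  have hc : Tendsto (fun k => (⌊t / ‖y k‖⌋ : ℝ) * ‖y k‖) atTop (𝓝 t) := by
    have hn : Tendsto (fun k => ‖y k‖) atTop (𝓝 0) := by simpa using hlim.norm
    refine tendsto_of_tendsto_of_tendsto_of_le_of_le (g := fun k => t - ‖y k‖) (h := fun _ => t)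
      (by simpa using hn.const_sub t) tendsto_const_nhds (fun k => ?_) (fun k => ?_)
    · have hp : 0 < ‖y k‖ := norm_pos_iff.2 (hy0 k)
      have h := mul_le_mul_of_nonneg_right (Int.sub_one_lt_floor (t / ‖y k‖)).le hp.le
      rwa [sub_mul, div_mul_cancel₀ _ hp.ne', one_mul] at h
    · have hp : 0 < ‖y k‖ := norm_pos_iff.2 (hy0 k)
      have h := mul_le_mul_of_nonneg_right (Int.floor_le (t / ‖y k‖)) hp.le
      rwa [div_mul_cancel₀ _ hp.ne'] at h
  have hz : Tendsto (fun k => ⌊t / ‖y k‖⌋ • y k) atTop (𝓝 (t • Y)) := by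
    refine (hc.smul hdir).congr fun k => ?_
    rw [smul_smul, mul_assoc, mul_inv_cancel₀ (norm_ne_zero_iff.2 (hy0 k)), mul_one,
      Int.cast_smul_eq_zsmul]
  obtain ⟨u, hu⟩ := isUnit_exp (t • Y)
  refine ⟨u, ?_, hu⟩
  have lim : Tendsto (fun k => g k ^ ⌊t / ‖y k‖⌋) atTop (𝓝 u) := by
    rw [Units.isOpenEmbedding_val.tendsto_nhds_iff, hu]
    refine ((exp_continuous.tendsto _).comp hz).congr fun k => ?_
    simp only [Function.comp_apply]
    rw [val_zpow_eq_exp_zsmul (hg k)]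
  exact hG.mem_of_tendsto lim (Eventually.of_forall fun k => G.zpow_mem (hgG k) _)

variable [FiniteDimensional ℝ A]

/-- A basis writes `L` as a finite sum of rank-one maps with values in the coinvariant span. -/
theorem hasGerm_of_range_le {G N : Subgroup Aˣ}
    (hN : ∀ g ∈ G, ∀ h ∈ N, g * h * g⁻¹ ∈ N) {L : A →L[ℝ] A}
    (hL : ∀ x, L x ∈ coinvariantSpan G N) : HasGerm N L := by
  let b := Module.finBasis ℝ A
  have e : L = ∑ i, (LinearMap.toContinuousLinearMap (b.coord i)).smulRight (L (b i)) := by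
    ext x : 1
    conv_lhs => rw [← b.sum_repr x, map_sum]
    simp [_root_.sum_apply]
  rw [e]
  exact HasGerm.sum _ fun i _ => hasGerm_smulRight hN (hL _) _

/-- Near `0`, a complement of the Lie algebra of the closed subgroup `G` meets `exp⁻¹ G` only
in `0`. -/
theorem eventually_eq_zero_of_exp_mem {G : Subgroup Aˣ}
    (hG : IsClosed (G : Set Aˣ)) {T p : Submodule ℝ A}
    (hT : ∀ X, IsExpTangent G X → X ∈ T) (hp : Disjoint T p) :
    ∀ᶠ y in 𝓝 (0 : A), y ∈ p → (∃ g ∈ G, (g : A) = exp y) → y = 0 := by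
  by_contra hcon
  -- The normalized counterexamples accumulate, by compactness of the sphere, at a unit vector that
  -- is tangent to `G` and lies in `p`.
  obtain ⟨y, hlim, hy⟩ := exists_seq_forall_of_frequently (not_eventually.1 hcon)
  push Not at hy
  have hy0 : ∀ k, y k ≠ 0 := fun k => (hy k).2.2
  have hunit : ∀ k, ‖y k‖⁻¹ • y k ∈ Metric.sphere (0 : A) 1 := fun k => by
    rw [mem_sphere_zero_iff_norm, norm_smul, norm_inv, norm_norm,
      inv_mul_cancel₀ (norm_ne_zero_iff.2 (hy0 k))]
  have : ProperSpace A := FiniteDimensional.proper ℝ A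
  obtain ⟨Y, hY1, σ, hσ, hdir⟩ :=
    (isCompact_sphere (0 : A) 1).tendsto_subseq hunit
  have hYG : IsExpTangent G Y := isExpTangent_of_tendsto_direction hG (y := y ∘ σ)
    (fun k => (hy (σ k)).2.1) (fun k => hy0 _) (hlim.comp hσ.tendsto_atTop) hdir
  have hcl : IsClosed (p : Set A) := Submodule.closed_of_finiteDimensional _
  have hYp : Y ∈ p := hcl.mem_of_tendsto hdir
    (Eventually.of_forall fun k => p.smul_mem _ (hy (σ k)).1)
  have hY0 : Y = 0 := Submodule.disjoint_def.1 hp Y (hT Y hYG) hYp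
  simp [hY0] at hY1

/-- A subgroup of the closed subgroup `G` which is normalized by `G` and whose coinvariant span
contains the Lie algebra of `G` is a neighbourhood of `1` in `G`. -/
theorem eventually_mem_of_le_coinvariantSpan {G N : Subgroup Aˣ}
    (hG : IsClosed (G : Set Aˣ)) (hNG : N ≤ G)
    (hN : ∀ g ∈ G, ∀ h ∈ N, g * h * g⁻¹ ∈ N)
    {T : Submodule ℝ A} (hT : ∀ X, IsExpTangent G X → X ∈ T) (hle : T ≤ coinvariantSpan G N) :
    ∀ᶠ g in 𝓝 (1 : Aˣ), g ∈ G → g ∈ N := by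
  obtain ⟨p, hp⟩ := T.exists_isCompl
  let π : A →L[ℝ] A := LinearMap.toContinuousLinearMap (T.projection p hp)
  have hπ : ∀ x, π x ∈ T := fun x => by simp [π]
  let ρ : A →L[ℝ] A := .id ℝ A - π
  have hρ : ∀ x, ρ x ∈ p := fun x => by
    have h : π (ρ x) = 0 := by
      rw [_root_.sub_apply, map_sub, ContinuousLinearMap.id_apply, sub_eq_zero]
      exact (T.projection_apply_of_mem_left hp (hπ x)).symm
    exact (T.projection_apply_eq_zero_iff hp).1 h
  obtain ⟨F, hFN, hF0, hF⟩ := hasGerm_of_range_le hN (L := π) fun x => hle (hπ x)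
  have hexp : HasStrictFDerivAt (fun x => exp (ρ x)) ρ 0 := by
    have h1 : HasStrictFDerivAt (exp : A → _) (1 : A →L[ℝ] A) (ρ 0) := by
      simpa using hasStrictFDerivAt_exp_zero (𝕂 := ℝ) (𝔸 := A)
    exact h1.comp 0 ρ.hasStrictFDerivAt
  -- `F` covers the directions in `T` inside `N`, and `exp ∘ ρ` covers the complement `p`; the
  -- derivatives add up to `π + ρ = id`, so the product reaches every point near `1`.
  have hΨ : HasStrictFDerivAt (fun x => (F x : A) * exp (ρ x)) (.id ℝ A) 0 := by
    have h := hF.mul' hexp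
    convert! h using 1
    ext x : 1
    simp [hF0, ρ]
  have hmap := hΨ.map_nhds_eq_of_surj (by simp)
  have hsmall : ∀ᶠ x in 𝓝 (0 : A), (∃ g ∈ G, (g : A) = exp (ρ x)) → ρ x = 0 := by
    have h0 : Tendsto ρ (𝓝 0) (𝓝 0) := by simpa using ρ.continuous.tendsto 0
    exact (h0.eventually (eventually_eq_zero_of_exp_mem hG hT hp.disjoint)).mono
      fun x hx => hx (hρ x)
  have hN1 : ∀ᶠ z in 𝓝 (1 : A), ∀ g ∈ G, (g : A) = z → g ∈ N := by
    have e1 : (F 0 : A) * exp (ρ 0) = 1 := by simp [hF0]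
    rw [← e1, ← hmap, eventually_map]
    filter_upwards [hsmall] with x hx g hg e
    -- For `g = F x * exp (ρ x)` in `G`, the factor `exp (ρ x)` is in `G` too, so its small exponent
    -- in `p` vanishes.
    have h0 : ρ x = 0 := by
      refine hx ⟨(F x)⁻¹ * g, G.mul_mem (G.inv_mem (hNG (hFN x))) hg, ?_⟩
      rw [Units.val_mul, e, Units.inv_mul_cancel_left]
    rw [h0, exp_zero, mul_one] at e
    rw [Units.ext e]
    exact hFN x
  have hval : Tendsto (fun g : Aˣ => (g : A)) (𝓝 1) (𝓝 1) :=
    Units.continuous_val.tendsto 1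
  exact (hval.eventually hN1).mono fun g h hg => h g hg rfl

end BanachAlgebra

/-! ### Lie algebras and normal subgroups of closed matrix groups -/

section LieGroups

open NormedSpace Filter Topology

attribute [local instance] LieRing.ofAssociativeRing

variable {n : ℕ}

open scoped Matrix.Norms.Operator in
/-- If `G` acts trivially on its Lie algebra modulo `m`, then `m` contains all brackets. -/
theorem lie_mem_of_conj_sub_mem {G : Subgroup (GL (Fin n) ℝ)}
    {m : Submodule ℝ (Matrix (Fin n) (Fin n) ℝ)} {X Y : Matrix (Fin n) (Fin n) ℝ}
    (hX : IsTangent G X)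
    (h : ∀ g ∈ G, (g : Matrix (Fin n) (Fin n) ℝ) * Y *
      ((g⁻¹ : GL (Fin n) ℝ) : Matrix (Fin n) (Fin n) ℝ) - Y ∈ m) : ⁅X, Y⁆ ∈ m := by
  have hcl : IsClosed (m : Set (Matrix (Fin n) (Fin n) ℝ)) :=
    Submodule.closed_of_finiteDimensional _
  have hconj : ∀ t : ℝ, exp (t • X) * Y * exp ((-t) • X) - Y ∈ m := by
    intro t
    obtain ⟨g, hg, e⟩ := hX t
    have e' : ((g⁻¹ : GL (Fin n) ℝ) : Matrix (Fin n) (Fin n) ℝ) = exp ((-t) • X) := by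
      rw [Matrix.coe_units_inv, e, neg_smul, Matrix.exp_neg]
    rw [← e, ← e']
    exact h g hg
  have hd : HasDerivAt (fun t : ℝ => exp (t • X) * Y * exp ((-t) • X)) ⁅X, Y⁆ 0 := by
    have h1 := (hasDerivAt_exp_smul_zero_aux X).mul_const Y
    have h2 : HasDerivAt (fun t : ℝ => exp ((-t) • X)) (-X) 0 := by
      simpa using hasDerivAt_exp_smul_zero_aux (-X)
    have h := h1.mul h2
    simp only [Pi.mul_def] at h
    convert! h using 1
    simp [LieRing.of_associative_ring_bracket, sub_eq_add_neg]
  have hslope := hasDerivAt_iff_tendsto_slope_zero.1 hd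
  refine hcl.mem_of_tendsto hslope (Eventually.of_forall fun t => m.smul_mem _ ?_)
  simpa using hconj t

/-- By perfectness the Lie algebra is the linear span of its brackets, so `m` need only be a
subspace. -/
theorem tangentSubmodule_le_of_lie_mem {G : Subgroup (GL (Fin n) ℝ)}
    (hG : IsConnectedSemisimpleLinearGroup G) {m : Submodule ℝ (Matrix (Fin n) (Fin n) ℝ)}
    (h : ∀ X Y, IsTangent G X → IsTangent G Y → ⁅X, Y⁆ ∈ m) :
    tangentSubmodule G hG.isClosed ≤ m := by
  have := hG.isSemisimple
  intro X hX
  have hp := LieAlgebra.IsSemisimple.lie_top_top_eq_top (R := ℝ)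
    (L := matrixLieAlgebra G hG.isClosed)
  have hs := congrArg LieSubmodule.toSubmodule hp
  rw [LieSubmodule.lieIdeal_oper_eq_linear_span] at hs
  have hle : Submodule.span ℝ {x : matrixLieAlgebra G hG.isClosed |
      ∃ (a : (⊤ : LieIdeal ℝ (matrixLieAlgebra G hG.isClosed)))
        (b : (⊤ : LieIdeal ℝ (matrixLieAlgebra G hG.isClosed))),
        ⁅(a : matrixLieAlgebra G hG.isClosed), (b : matrixLieAlgebra G hG.isClosed)⁆ = x} ≤
      m.comap (matrixLieAlgebra G hG.isClosed).toSubmodule.subtype := by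
    refine Submodule.span_le.2 ?_
    rintro _ ⟨a, b, rfl⟩
    exact h _ _ a.1.2 b.1.2
  have := hle (hs.symm ▸ Submodule.mem_top : (⟨X, hX⟩ : matrixLieAlgebra G hG.isClosed) ∈ _)
  exact this

/-- The span of the vectors `X - h X h⁻¹`, where `X` is tangent to the matrix group `G` and `h`
belongs to `N`. -/
def matrixCoinvariantSpan (G N : Subgroup (GL (Fin n) ℝ)) :
    Submodule ℝ (Matrix (Fin n) (Fin n) ℝ) :=
  Submodule.span ℝ {Z | ∃ X, IsTangent G X ∧ ∃ h ∈ N, Z = X - (h : Matrix (Fin n) (Fin n) ℝ) * X *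
    ((h⁻¹ : GL (Fin n) ℝ) : Matrix (Fin n) (Fin n) ℝ)}

open scoped Matrix.Norms.Operator in
theorem eventually_mem_of_tangentSubmodule_le {G N : Subgroup (GL (Fin n) ℝ)}
    (hG : IsClosed (G : Set (GL (Fin n) ℝ))) (hNG : N ≤ G)
    (hN : ∀ g ∈ G, ∀ h ∈ N, g * h * g⁻¹ ∈ N)
    (hle : tangentSubmodule G hG ≤ matrixCoinvariantSpan G N) :
    ∀ᶠ g in 𝓝 (1 : GL (Fin n) ℝ), g ∈ G → g ∈ N :=
  eventually_mem_of_le_coinvariantSpan hG hNG hN (fun _ hX => hX) hle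

/-- An abstract normal subgroup of a connected closed matrix group `G` is all of `G` as soon as its
coinvariant span contains the Lie algebra of `G`. -/
theorem eq_top_of_tangentSubmodule_le {G : Subgroup (GL (Fin n) ℝ)}
    (hG : IsClosed (G : Set (GL (Fin n) ℝ))) (hconn : IsConnected (G : Set (GL (Fin n) ℝ)))
    (N : Subgroup G) [hN : N.Normal]
    (hle : tangentSubmodule G hG ≤ matrixCoinvariantSpan G (N.map G.subtype)) : N = ⊤ := by
  have h := eventually_mem_of_tangentSubmodule_le hG (Subgroup.map_subtype_le N) (by
      rintro g hg _ ⟨h, hh, rfl⟩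
      exact ⟨_, hN.conj_mem h hh ⟨g, hg⟩, rfl⟩) hle
  have h1 : ∀ᶠ g in 𝓝 (1 : G), g ∈ N := by
    have hval : Tendsto (fun g : G => (g : GL (Fin n) ℝ)) (𝓝 1) (𝓝 1) :=
      continuous_subtype_val.tendsto 1
    filter_upwards [hval.eventually h] with g hg
    obtain ⟨x, hx, e⟩ := hg g.2
    rwa [← Subtype.ext e]
  have hopen : IsOpen (N : Set G) := N.isOpen_of_mem_nhds h1
  have : ConnectedSpace G := isConnected_iff_connectedSpace.1 hconn
  have := IsClopen.eq_univ ⟨N.isClosed_of_isOpen hopen, hopen⟩ ⟨1, N.one_mem⟩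
  exact SetLike.coe_injective (by simpa using this)

end LieGroups

/-! ### Zariski dense normal subgroups and the proposition -/

section MainTheorem

variable {n : ℕ}

/-- A Zariski dense normal subgroup of a connected semisimple linear group is the whole group. -/
theorem IsConnectedSemisimpleLinearGroup.eq_top_of_isZariskiDense {G : Subgroup (GL (Fin n) ℝ)}
    (hG : IsConnectedSemisimpleLinearGroup G) (N : Subgroup G) [N.Normal]
    (hN : IsZariskiDense N) : N = ⊤ := by
  -- Here `m` is the coinvariant span of `N`; density of `N` carries the condition `g Y g⁻¹ - Y ∈ m`
  -- from `N` to `G`.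
  refine eq_top_of_tangentSubmodule_le hG.isClosed hG.isConnected N
    (tangentSubmodule_le_of_lie_mem hG fun X Y hX hY => lie_mem_of_conj_sub_mem hX fun g hg =>
      conj_sub_mem_of_mem_zariskiClosure ?_ (hN hg))
  rintro _ ⟨h, hh, rfl⟩
  rw [← neg_sub]
  exact neg_mem (Submodule.subset_span ⟨Y, hY, h, ⟨h, hh, rfl⟩, rfl⟩)

/-- If `Γ` is Zariski dense in `G` and normalizes the subgroup `H` of `G`, then the Zariski closure
of `H` in `G` is normal. -/
theorem IsZariskiDense.normal_zariskiClosureSubgroup {G : Subgroup (GL (Fin n) ℝ)}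
    {Γ H : Subgroup G} (hΓ : IsZariskiDense Γ) (h : ∀ γ ∈ Γ, ∀ x ∈ H, γ * x * γ⁻¹ ∈ H) :
    ((zariskiClosureSubgroup (H.map G.subtype)).comap G.subtype).Normal := by
  refine ⟨fun x hx g => conj_mem_zariskiClosure ?_ (hΓ g.2) hx⟩
  rintro _ ⟨γ, hγ, rfl⟩ _ ⟨y, hy, rfl⟩
  exact ⟨_, h γ hγ y hy, rfl⟩

end MainTheorem

theorem mainTheorem5 (n : ℕ) (G : Subgroup (GL (Fin n) ℝ))
    (hG : IsConnectedSemisimpleLinearGroup G) (Γ : Subgroup G) (hΓ : IsZariskiDense Γ) :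
    (∀ Γ' : Subgroup Γ, Γ'.Normal → Γ' ≠ ⊥ → IsZariskiDense (Γ'.map Γ.subtype)) ↔
      IsNormallyIrreducible Γ := by
  constructor
  · intro h N hN hne
    by_contra hbot
    refine hne (hG.eq_top_of_isZariskiDense N ?_)
    have hd := h (N.subgroupOf Γ) inferInstance fun hb => hbot ?_
    · refine hd.trans (zariskiClosure_mono (Set.image_mono ?_))
      rw [Subgroup.subgroupOf_map_subtype]
      exact fun x hx => hx.1
    · rw [← Subgroup.subgroupOf_map_subtype, hb, Subgroup.map_bot]
  · intro h Γ' hΓ' hne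
    have hnorm := hΓ.normal_zariskiClosureSubgroup (H := Γ'.map Γ.subtype) (by
      rintro γ hγ _ ⟨x, hx, rfl⟩
      exact ⟨_, hΓ'.conj_mem x hx ⟨γ, hγ⟩, rfl⟩)
    have htop : (zariskiClosureSubgroup ((Γ'.map Γ.subtype).map G.subtype)).comap G.subtype = ⊤ := by
      by_contra htop
      -- The closure is normal in `G` and assumed proper, so it meets `Γ` trivially; yet it contains
      -- `Γ'`.
      refine hne (eq_bot_iff.2 fun x hx => ?_)
      have hmem : (x : G) ∈ (zariskiClosureSubgroup ((Γ'.map Γ.subtype).map G.subtype)).comap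
          G.subtype ⊓ Γ :=
        ⟨subset_zariskiClosure _ ⟨x, ⟨x, hx, rfl⟩, rfl⟩, x.2⟩
      rw [h _ hnorm htop, Subgroup.mem_bot] at hmem
      exact Subgroup.mem_bot.2 (Subtype.ext hmem)
    intro g hg
    have hgm : (⟨g, hg⟩ : G) ∈ (zariskiClosureSubgroup
        ((Γ'.map Γ.subtype).map G.subtype)).comap G.subtype := htop ▸ Subgroup.mem_top _
    exact hgm
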